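/- Let $(\mathcal{A},\mathbb{E},\mathcal{B})$ be an operator-valued $C^*$-probability space: $\mathcal{A}$ is a unital $C^*$-algebra, $\mathcal{B}$ is a $C^*$-algebra unitally embedded in $\mathcal{A}$, and $\mathbb{E}:\mathcal{A}\to\mathcal{B}$ is a conditional expectation, i.e. a positive linear map with $\mathbb{E}[b]=b$ and $\mathbb{E}[b_1xb_2]=b_1\mathbb{E}[x]b_2$ for $b,b_1,b_2\in\mathcal{B}$, $x\in\mathcal{A}$. Put $\operatorname{Im}(b)=\frac{1}{2i}(b-b^*)$ and $\mathbb{H}^{\pm}(\mathcal{B})=\{b\in\mathcal{B}\mid \exists\,\varepsilon>0:\ \pm\operatorname{Im}(b)\ge\varepsilon 1\}$. Let $\eta:\mathcal{B}\to\mathcal{B}$ be a completely positive linear map and let $s=s^*\in\mathcal{A}$ be a centered $\mathcal{B}$-valued semicircular element with covariance $\eta$, i.e. $$\mathbb{E}[s b_1 s b_2\cdots s b_{k-1} s]=\sum_{\pi\in NC_2(k)}\eta_\pi(b_1,\dots,b_{k-1})\qquad\text{for all } k\ge 1,\ b_1,\dots,b_{k-1}\in\mathcal{B},$$ where $NC_2(k)$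 is the set of non-crossing pairings of $\{1,\dots,k\}$ and $\eta_\pi(b_1,\dots,b_{k-1})$ is obtained from the word $s b_1 s\cdots b_{k-1}s$ by replacing, for each block $\{m<n\}$ of $\pi$, the $m$-th and $n$-th letters $s$ and the expression between them by $\eta$ applied to that expression. Let $G_s(b)=\mathbb{E}[(b-s)^{-1}]$ for $b\in\mathbb{H}^+(\mathcal{B})$, let $\Delta_b(w)=b-w^{-1}-\eta(w)$ for $w\in\mathbb{H}^-(\mathcal{B})$, and, for a state $\phi$ on $\mathcal{B}$, let $\Theta_s(b)=-\|\operatorname{Im}(b)^{-1}\|^{-1}\operatorname{Im}(\phi(G_s(b)))$. Fix $b\in\mathbb{H}^+(\mathcal{B})$ and put $w_*=G_s(b)$. Then $w_*\in\mathbb{H}^-(\mathcal{B})$, and $w_*$ is the unique solution $w\in\mathbb{H}^-(\mathcal{B})$ of the equation $bw=1+\eta(w)w$. Moreover, suppose that $\tilde w\in\mathbb{H}^-(\mathcal{B})$ satisfies $$\|\Delta_b(\tilde w)\|\le\sigma\,\|\operatorname{Im}(b)^{-1}\|^{-1}\quad\text{for some }\sigma\in(0,1).$$ Then $$\|\tilde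 w-w_*\|\le\frac{1}{1-\sigma}\|\operatorname{Im}(b)^{-1}\|^2\,\|\Delta_b(\tilde w)\|\le\frac{\sigma}{1-\sigma}\|\operatorname{Im}(b)^{-1}\|,$$ and for every state $\phi$ on $\mathcal{B}$, $$|\phi(\tilde w)-\phi(w_*)|\le\frac{1}{1-\sigma}\sqrt{\Theta_s(b)}\,\|\operatorname{Im}(b)^{-1}\|^2\,\|\Delta_b(\tilde w)\|\le\frac{\sigma}{1-\sigma}\sqrt{\Theta_s(b)}\,\|\operatorname{Im}(b)^{-1}\|.$$ -/

import Mathlib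

open scoped CStarAlgebra ComplexStarModule ComplexOrder

noncomputable section

namespace OpValued

/-! ### Non-crossing pairings -/

/-- `π` is a non-crossing pairing of the interval of integers `{i + 1, …, l}`.
A block `{m, n}` with `m < n` is recorded as the pair `(m, n)`. -/
structure IsNCPairing (i l : ℕ) (π : Finset (ℕ × ℕ)) : Prop where
  mem_Ioc : ∀ p ∈ π, i < p.1 ∧ p.1 < p.2 ∧ p.2 ≤ l
  cover : ∀ m, i < m → m ≤ l → ∃! p, p ∈ π ∧ (p.1 = m ∨ p.2 = m)
  noncrossing : ∀ p ∈ π, ∀ q ∈ π, ¬ (p.1 < q.1 ∧ q.1 < p.2 ∧ p.2 < q.2)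

open Classical in
/-- The finite set of all non-crossing pairings of `{i + 1, …, l}`. -/
def ncPairings (i l : ℕ) : Finset (Finset (ℕ × ℕ)) :=
  (Finset.Ioc i l ×ˢ Finset.Ioc i l).powerset.filter (IsNCPairing i l)

theorem mem_ncPairings {i l : ℕ} {π : Finset (ℕ × ℕ)} :
    π ∈ ncPairings i l ↔ IsNCPairing i l π := by
  classical
  simp only [ncPairings, Finset.mem_filter, Finset.mem_powerset, and_iff_right_iff_imp]
  intro h p hp
  have := h.mem_Ioc p hp
  simp only [Finset.mem_product, Finset.mem_Ioc]
  omega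

/-- `NC₂(k)`: the non-crossing pairings of `{1, …, k}`. -/
def NC2 (k : ℕ) : Finset (Finset (ℕ × ℕ)) := ncPairings 0 k

open Classical in
/-- The value obtained from the formal word `b_i x_{i+1} b_{i+1} x_{i+2} ⋯ x_l b_l` when the letters
`x_m` are grouped according to the blocks of the non-crossing pairing `π`, each block
`x_m (⋯) x_n` being replaced by `η (⋯)`: if `j` is the (unique) partner of `i + 1`, this is
`b_i * η (value of b_{i+1} x_{i+2} ⋯ b_{j-1}) * (value of b_j x_{j+1} ⋯ b_l)`. -/
def pairingValue {B : Type*} [Mul B] (η : B → B) (π : Finset (ℕ × ℕ)) (b : ℕ → B) (i l : ℕ) : B :=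
  if h : ∃ j, i + 1 < j ∧ j ≤ l ∧ (i + 1, j) ∈ π then
    b i * η (pairingValue η π b (i + 1) (h.choose - 1)) * pairingValue η π b h.choose l
  else b i
termination_by l - i
decreasing_by
  all_goals
    have h1 := h.choose_spec
    omega

/-- `η_π(b_1, …, b_{k-1})` for `π ∈ NC₂(k)`; only the values `b 1, …, b (k - 1)` are used. -/
def etaPi {B : Type*} [Monoid B] (η : B → B) (k : ℕ) (π : Finset (ℕ × ℕ)) (b : ℕ → B) : B :=
  pairingValue η π (fun m => if 0 < m ∧ m < k then b m else 1) 0 k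

/-- The word `x b_1 x b_2 ⋯ x b_{k-1} x` (with `k` letters `x`, for `k ≥ 1`). -/
def word {A : Type*} [Monoid A] (x : A) (k : ℕ) (b : ℕ → A) : A :=
  x * ((List.range (k - 1)).map fun m => b (m + 1) * x).prod

/-! ### Half-planes, states, operator-valued probability spaces -/

section

variable {A B : Type*} [CStarAlgebra A] [CStarAlgebra B] [PartialOrder B] [StarOrderedRing B]

variable (B) in
/-- The upper half-plane `ℍ⁺(B)`. -/
def upperHalfPlane : Set B := {b | ∃ ε : ℝ, 0 < ε ∧ ε • (1 : B) ≤ (ℑ b : B)}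

variable (B) in
/-- The lower half-plane `ℍ⁻(B)`. -/
def lowerHalfPlane : Set B := {b | ∃ ε : ℝ, 0 < ε ∧ ε • (1 : B) ≤ -(ℑ b : B)}

/-- States on a unital C⋆-algebra: positive continuous linear functionals of norm one. -/
structure IsState {C : Type*} [CStarAlgebra C] (φ : C →L[ℂ] ℂ) : Prop where
  nonneg : ∀ x, 0 ≤ φ (star x * x)
  norm_eq_one : ‖φ‖ = 1

variable (A B) in
/-- An operator-valued C⋆-probability space `(A, E, B)`: a unital C⋆-algebra `A`, a unital
C⋆-algebra `B` that is unitally embedded in `A` by the ⋆-homomorphism `ι` (injective by `E_ι`),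
and a conditional expectation `E` of `A` onto `B`. -/
structure OpValuedCStarProbSpace where
  ι : B →⋆ₐ[ℂ] A
  E : A →ₗ[ℂ] B
  E_nonneg : ∀ x : A, 0 ≤ E (star x * x)
  E_ι : ∀ b : B, E (ι b) = b
  E_bimodule : ∀ (b₁ : B) (x : A) (b₂ : B), E (ι b₁ * x * ι b₂) = b₁ * E x * b₂

namespace OpValuedCStarProbSpace

variable (P : OpValuedCStarProbSpace A B)

/-- `s` is a centered `B`-valued semicircular element with covariance `η`. -/
structure IsCenteredSemicircular (s : A) (η : B →CP B) : Prop where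
  isSelfAdjoint : IsSelfAdjoint s
  moments : ∀ k : ℕ, 1 ≤ k → ∀ b : ℕ → B,
    P.E (word s k fun m => P.ι (b m)) = ∑ π ∈ NC2 k, etaPi η k π b

/-- The `B`-valued Cauchy transform `G_x(b) = E[(b - x)⁻¹]`. -/
def cauchyTransform (x : A) (b : B) : B := P.E (Ring.inverse (P.ι b - x))

/-- `Θ_x(b) = - ‖Im(b)⁻¹‖⁻¹ Im(φ(G_x(b)))`. -/
def Theta (φ : B →L[ℂ] ℂ) (x : A) (b : B) : ℝ :=
  -(‖Ring.inverse (ℑ b : B)‖⁻¹ * (φ (P.cauchyTransform x b)).im)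

end OpValuedCStarProbSpace

/-- `Δ_b(w) = b - w⁻¹ - η(w)`. -/
def Delta (η : B →CP B) (b w : B) : B := b - Ring.inverse w - η w

end

end OpValued

end

/-! An approximate solution for `b` is an exact solution for a shifted point: with `D = Δ_b(w)`, one
has `(b - D) w = 1 + η(w) w`. If `‖D‖ ≤ σ κ`, where `κ = ‖Im(b)⁻¹‖⁻¹`, then `Im(b - D) ≥ (1 - σ) κ`,
so `b - D` stays in the upper half-plane and uniqueness there forces `w = G_s(b - D)`. The resolvent
identity gives `w - G_s(b) = E[(b - D - s)⁻¹ D (b - s)⁻¹]`, and the resolvent bounds `((1 - σ) κ)⁻¹`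
and `κ⁻¹` yield the norm estimate. For a state `φ`, Cauchy–Schwarz for `φ ∘ E` replaces the second
bound by the square root of `φ(E[y* y])`, `y = (b - s)⁻¹`, which is controlled by `κ y* y ≤ -Im y`.

The equation for `G_s` (`IsCenteredSemicircular.equation`) comes from the Neumann series when
`Im(b)` is large: splitting a non-crossing pairing at the block of the first letter gives a
Catalan-type recursion, i.e. `G = b⁻¹ + b⁻¹ η(G) G`. Analytic continuation along `b + z 1` does the
rest.

Uniqueness (`eq_of_mul_eq_one_add`) uses complete positivity through `2 × 2` matrices. The
difference `x` of two solutions satisfies `x = w₁ η(x) w₂`, while `vᵢ = -Im wᵢ` are strictly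
contracted by the corresponding maps. Iterating on a positive matrix with diagonal `c v₁, c v₂` and
off-diagonal `x, x*` shrinks the diagonal to zero and leaves `x` unchanged, hence `x = 0`. -/

namespace OpValued

/-! ### Half-planes, invertibility and imaginary parts of inverses -/

section HalfPlane

variable {C : Type*} [CStarAlgebra C] [PartialOrder C] [StarOrderedRing C]

theorem isStrictlyPositive_of_smul_one_le {a : C} {ε : ℝ} (hε : 0 < ε) (h : ε • (1 : C) ≤ a) :
    IsStrictlyPositive a :=
  (isStrictlyPositive_one.smul hε).of_le h

theorem exists_smul_one_le {a : C} (ha : IsStrictlyPositive a) :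
    ∃ ε : ℝ, 0 < ε ∧ ε • (1 : C) ≤ a := by
  nontriviality C using exists_gt (0 : ℝ)
  obtain ⟨r, hr, h⟩ := (CFC.exists_pos_algebraMap_le_iff (a := a) ha.isSelfAdjoint).2
    fun x hx => ha.spectrum_pos hx
  exact ⟨r, hr, by rwa [← Algebra.algebraMap_eq_smul_one]⟩

theorem mem_upperHalfPlane_iff {b : C} :
    b ∈ upperHalfPlane C ↔ IsStrictlyPositive (ℑ b : C) :=
  ⟨fun ⟨_, hε, h⟩ => isStrictlyPositive_of_smul_one_le hε h, fun h => exists_smul_one_le h⟩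

theorem mem_lowerHalfPlane_iff {b : C} :
    b ∈ lowerHalfPlane C ↔ IsStrictlyPositive (-(ℑ b : C)) :=
  ⟨fun ⟨_, hε, h⟩ => isStrictlyPositive_of_smul_one_le hε h, fun h => exists_smul_one_le h⟩

omit [PartialOrder C] [StarOrderedRing C] in
theorem imaginaryPart_star_conj (x y : C) :
    (ℑ (star y * x * y) : C) = star y * (ℑ x : C) * y := by
  simp only [imaginaryPart_apply_coe, star_mul, star_star, mul_smul_comm, smul_mul_assoc,
    mul_sub, sub_mul, mul_assoc]

omit [PartialOrder C] [StarOrderedRing C] in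
theorem imaginaryPart_star (x : C) : (ℑ (star x) : C) = -(ℑ x : C) := by
  simp only [imaginaryPart_apply_coe, star_star, ← smul_neg, neg_sub]

omit [PartialOrder C] [StarOrderedRing C] in
-- Take imaginary parts in `y* x y = y*`.
theorem neg_imaginaryPart_eq_star_conj {x y : C} (h : x * y = 1) :
    -(ℑ y : C) = star y * (ℑ x : C) * y := by
  rw [← imaginaryPart_star_conj, mul_assoc, h, mul_one, imaginaryPart_star]

omit [PartialOrder C] [StarOrderedRing C] in
theorem neg_imaginaryPart_eq_conj_star {x y : C} (h : y * x = 1) :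
    -(ℑ y : C) = y * (ℑ x : C) * star y := by
  have := imaginaryPart_star_conj x (star y)
  rw [star_star, h, one_mul, imaginaryPart_star] at this
  exact this

/-- With `u` the square root of `Im x`, one has `x = u (k + i) u` for a self-adjoint `k`, whose
spectrum is real and so misses `-i`. -/
theorem isUnit_of_isStrictlyPositive_imaginaryPart {x : C}
    (h : IsStrictlyPositive (ℑ x : C)) : IsUnit x := by
  obtain ⟨u, hu⟩ : IsUnit (CFC.sqrt (ℑ x : C)) := by
    exact CFC.isUnit_sqrt_iff _ |>.2 h.isUnit
  have hsq : (u : C) * u = (ℑ x : C) := by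
    rw [hu]; exact CFC.sqrt_mul_sqrt_self _ h.nonneg
  have hus : IsSelfAdjoint (u : C) := by rw [hu]; exact (CFC.sqrt_nonneg _).isSelfAdjoint
  have hus' : IsSelfAdjoint (↑u⁻¹ : C) := by
    have : IsSelfAdjoint u := Units.ext hus
    exact congrArg Units.val this.inv
  set k : C := ↑u⁻¹ * (ℜ x : C) * ↑u⁻¹ with hk
  have hks : IsSelfAdjoint k := by
    have := (ℜ x).2.conjugate (↑u⁻¹ : C)
    rwa [hus'.star_eq] at this
  have hunit : IsUnit (k + Complex.I • (1 : C)) := by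
    have h1 : (-Complex.I) ∉ spectrum ℂ k := by
      intro hmem
      have := hks.mem_spectrum_eq_re hmem
      simpa using congrArg Complex.im this
    rw [spectrum.notMem_iff] at h1
    rw [← IsUnit.neg_iff]
    convert h1 using 1
    rw [Algebra.algebraMap_eq_smul_one]
    module
  have hx : x = u * (k + Complex.I • (1 : C)) * u := by
    have h2 : (u : C) * k * u = ℜ x := by simp [hk, mul_assoc]
    rw [mul_add, add_mul, h2, mul_smul_comm, mul_one, smul_mul_assoc, hsq]
    exact (realPart_add_I_smul_imaginaryPart x).symm
  rw [hx]
  exact (u.isUnit.mul hunit).mul u.isUnit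

theorem isUnit_of_mem_upperHalfPlane {x : C} (h : x ∈ upperHalfPlane C) : IsUnit x :=
  isUnit_of_isStrictlyPositive_imaginaryPart (mem_upperHalfPlane_iff.1 h)

theorem isUnit_of_mem_lowerHalfPlane {x : C} (h : x ∈ lowerHalfPlane C) : IsUnit x := by
  rw [← IsUnit.neg_iff]
  apply isUnit_of_isStrictlyPositive_imaginaryPart
  simpa using mem_lowerHalfPlane_iff.1 h

/-- For `y = x⁻¹`, `ε y* y ≤ y* (Im x) y = -Im y`, so `ε ‖y‖² ≤ ‖y‖`. -/
theorem norm_inverse_le_of_smul_one_le_imaginaryPart {x : C} {ε : ℝ} (hε : 0 < ε)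
    (h : ε • (1 : C) ≤ (ℑ x : C)) : ‖Ring.inverse x‖ ≤ ε⁻¹ := by
  have hx := isUnit_of_mem_upperHalfPlane ⟨ε, hε, h⟩
  set y := Ring.inverse x with hy
  have h1 := neg_imaginaryPart_eq_star_conj (Ring.mul_inverse_cancel x hx)
  rw [← hy] at h1
  have h2 : ε • (star y * y) ≤ -(ℑ y : C) := by
    rw [h1]
    simpa using star_left_conjugate_le_conjugate h y
  have h3 := CStarAlgebra.norm_le_norm_of_nonneg_of_le
    (smul_nonneg hε.le (star_mul_self_nonneg y)) h2
  rw [norm_smul, CStarRing.norm_star_mul_self, norm_neg, Real.norm_of_nonneg hε.le] at h3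
  have h4 : ‖(ℑ y : C)‖ ≤ ‖y‖ := imaginaryPart.norm_le y
  rcases (norm_nonneg y).eq_or_lt with h0 | h0
  · rw [← h0]; positivity
  · rw [le_inv_comm₀ h0 hε, ← one_div, le_div_iff₀ h0]
    nlinarith

theorem isStrictlyPositive_neg_imaginaryPart_inverse {x : C}
    (h : IsStrictlyPositive (ℑ x : C)) : IsStrictlyPositive (-(ℑ (Ring.inverse x) : C)) := by
  have hx := isUnit_of_isStrictlyPositive_imaginaryPart h
  rw [neg_imaginaryPart_eq_star_conj (Ring.mul_inverse_cancel x hx)]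
  exact ⟨star_left_conjugate_nonneg h.nonneg _,
    ((hx.ringInverse.star).mul h.isUnit).mul hx.ringInverse⟩

omit [PartialOrder C] [StarOrderedRing C] in
theorem norm_inverse_pos [Nontrivial C] {p : C} (hp : IsUnit p) : 0 < ‖Ring.inverse p‖ :=
  norm_pos_iff.2 hp.ringInverse.ne_zero

theorem inv_norm_inverse_smul_one_le {p : C} (hp : IsStrictlyPositive p) :
    ‖Ring.inverse p‖⁻¹ • (1 : C) ≤ p := by
  nontriviality C
  have h0 := norm_inverse_pos hp.isUnit
  have hq : IsStrictlyPositive (Ring.inverse p) := hp.ringInverse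
  have h1 : Ring.inverse p ≤ ‖Ring.inverse p‖ • (1 : C) := by
    rw [← Algebra.algebraMap_eq_smul_one]
    exact IsSelfAdjoint.le_algebraMap_norm_self hq.isSelfAdjoint
  have h2 := CStarAlgebra.ringInverse_le_ringInverse h1 hq
  rw [Ring.inverse_inverse hp.isUnit] at h2
  refine le_of_eq_of_le ?_ h2
  have h3 : IsUnit (‖Ring.inverse p‖ • (1 : C)) := (isStrictlyPositive_one.smul h0).isUnit
  rw [← mul_one (Ring.inverse (_ • _)), eq_comm, Ring.inverse_mul_eq_iff_eq_mul _ _ _ h3,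
    smul_mul_smul_comm, mul_inv_cancel₀ h0.ne', one_smul, one_mul]

end HalfPlane
-- Non-crossing pairings and their recursion
section Pairings

theorem IsNCPairing.eq_of_share {i l : ℕ} {π : Finset (ℕ × ℕ)} (h : IsNCPairing i l π)
    {p q : ℕ × ℕ} (hp : p ∈ π) (hq : q ∈ π) {m : ℕ} (hpm : p.1 = m ∨ p.2 = m)
    (hqm : q.1 = m ∨ q.2 = m) : p = q := by
  have h1 := h.mem_Ioc p hp
  exact (h.cover m (by omega) (by omega)).unique ⟨hp, hpm⟩ ⟨hq, hqm⟩

/-- The recursion only looks at blocks inside the interval, so a pairing may be evaluated on a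
subinterval without being restricted first. -/
theorem pairingValue_congr {B : Type*} [Mul B] (η : B → B) {π π' : Finset (ℕ × ℕ)} {b b' : ℕ → B}
    {i l : ℕ} (hil : i ≤ l) (hπ : ∀ p : ℕ × ℕ, i < p.1 → p.1 < p.2 → p.2 ≤ l → (p ∈ π ↔ p ∈ π'))
    (hb : ∀ m, i ≤ m → m ≤ l → b m = b' m) :
    pairingValue η π b i l = pairingValue η π' b' i l := by
  induction h : l - i using Nat.strong_induction_on generalizing i l with
  | _ n ih =>
    -- Equality of the predicates as functions makes the two `choose` witnesses coincide.
    have hpred : (fun j => i + 1 < j ∧ j ≤ l ∧ (i + 1, j) ∈ π) =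
        fun j => i + 1 < j ∧ j ≤ l ∧ (i + 1, j) ∈ π' := by
      funext j
      refine propext (and_congr_right fun h1 => and_congr_right fun h2 => ?_)
      exact hπ _ (by simp) h1 h2
    rw [pairingValue, pairingValue]
    by_cases hex : ∃ j, i + 1 < j ∧ j ≤ l ∧ (i + 1, j) ∈ π
    · have hex' : ∃ j, i + 1 < j ∧ j ≤ l ∧ (i + 1, j) ∈ π' := by
        obtain ⟨j, hj⟩ := hex
        exact ⟨j, (congrFun hpred j).mp hj⟩
      have hch : hex.choose = hex'.choose := by
        congr 1
      rw [dif_pos hex, dif_pos hex', ← hch]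
      obtain ⟨h1, h2, -⟩ := hex.choose_spec
      rw [hb i le_rfl hil, ih _ (by omega) (by omega) _ _ rfl, ih _ (by omega) (by omega) _ _ rfl]
      · exact fun p a b c => hπ p (by omega) b c
      · exact fun m a c => hb m (by omega) c
      · exact fun p a b c => hπ p (by omega) b (by omega)
      · exact fun m a c => hb m (by omega) (by omega)
    · have hex' : ¬ ∃ j, i + 1 < j ∧ j ≤ l ∧ (i + 1, j) ∈ π' := by
        rintro ⟨j, hj⟩
        exact hex ⟨j, (congrFun hpred j).mpr hj⟩
      rw [dif_neg hex, dif_neg hex', hb i le_rfl hil]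

theorem IsNCPairing.pairingValue_eq {B : Type*} [Mul B] (η : B → B) {π : Finset (ℕ × ℕ)}
    (b : ℕ → B) {i l j : ℕ} (hπ : IsNCPairing i l π) (hj : (i + 1, j) ∈ π) :
    pairingValue η π b i l =
      b i * η (pairingValue η π b (i + 1) (j - 1)) * pairingValue η π b j l := by
  have hb := hπ.mem_Ioc _ hj
  have hex : ∃ j, i + 1 < j ∧ j ≤ l ∧ (i + 1, j) ∈ π := ⟨j, hb.2.1, hb.2.2, hj⟩
  have hch : hex.choose = j := by
    have := hπ.eq_of_share hex.choose_spec.2.2 hj (m := i + 1) (Or.inl rfl) (Or.inl rfl)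
    exact congrArg Prod.snd this
  rw [pairingValue, dif_pos hex, hch]

open Classical in
/-- The non-crossing pairing of `{i + 1, …, l}` with block `{i + 1, j}`, made of a pairing of
`{i + 2, …, j - 1}` and a pairing of `{j + 1, …, l}`. -/
def joinPairings (i j : ℕ) (π₁ π₂ : Finset (ℕ × ℕ)) : Finset (ℕ × ℕ) :=
  insert (i + 1, j) (π₁ ∪ π₂)

theorem mem_joinPairings {i j : ℕ} {π₁ π₂ : Finset (ℕ × ℕ)} {p : ℕ × ℕ} :
    p ∈ joinPairings i j π₁ π₂ ↔ p = (i + 1, j) ∨ p ∈ π₁ ∨ p ∈ π₂ := by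
  classical
  simp [joinPairings]

theorem isNCPairing_joinPairings {i j l : ℕ} (hij : i + 1 < j) (hjl : j ≤ l)
    {π₁ π₂ : Finset (ℕ × ℕ)} (h₁ : IsNCPairing (i + 1) (j - 1) π₁) (h₂ : IsNCPairing j l π₂) :
    IsNCPairing i l (joinPairings i j π₁ π₂) where
  mem_Ioc p hp := by
    rcases mem_joinPairings.1 hp with rfl | hp | hp
    · exact ⟨by simp, hij, hjl⟩
    · have := h₁.mem_Ioc p hp
      omega
    · have := h₂.mem_Ioc p hp
      omega
  cover m hm hml := by
    by_cases hm0 : m = i + 1 ∨ m = j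
    · refine ⟨(i + 1, j), ⟨mem_joinPairings.2 (.inl rfl), by grind⟩, ?_⟩
      rintro p ⟨hp, hpm⟩
      rcases mem_joinPairings.1 hp with rfl | hp | hp
      · rfl
      · have := h₁.mem_Ioc p hp
        omega
      · have := h₂.mem_Ioc p hp
        omega
    · by_cases hmj : m < j
      · obtain ⟨p, ⟨hp, hpm⟩, hu⟩ := h₁.cover m (by omega) (by omega)
        refine ⟨p, ⟨mem_joinPairings.2 (.inr (.inl hp)), hpm⟩, ?_⟩
        rintro q ⟨hq, hqm⟩
        rcases mem_joinPairings.1 hq with rfl | hq | hq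
        · exfalso
          simp only at hqm
          omega
        · exact hu q ⟨hq, hqm⟩
        · have := h₂.mem_Ioc q hq
          omega
      · obtain ⟨p, ⟨hp, hpm⟩, hu⟩ := h₂.cover m (by omega) (by omega)
        refine ⟨p, ⟨mem_joinPairings.2 (.inr (.inr hp)), hpm⟩, ?_⟩
        rintro q ⟨hq, hqm⟩
        rcases mem_joinPairings.1 hq with rfl | hq | hq
        · exfalso
          simp only at hqm
          omega
        · have := h₁.mem_Ioc q hq
          omega
        · exact hu q ⟨hq, hqm⟩
  noncrossing p hp q hq := by
    rcases mem_joinPairings.1 hp with rfl | hp | hp <;>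
      rcases mem_joinPairings.1 hq with rfl | hq | hq
    · simp
    · have := h₁.mem_Ioc q hq
      simp only
      omega
    · have := h₂.mem_Ioc q hq
      simp only
      omega
    · have := h₁.mem_Ioc p hp
      simp only
      omega
    · exact h₁.noncrossing p hp q hq
    · have := h₁.mem_Ioc p hp
      have := h₂.mem_Ioc q hq
      omega
    · have := h₂.mem_Ioc p hp
      simp only
      omega
    · have := h₂.mem_Ioc p hp
      have := h₁.mem_Ioc q hq
      omega
    · exact h₂.noncrossing p hp q hq

theorem exists_joinPairings_eq {i j l : ℕ} {π : Finset (ℕ × ℕ)} (hπ : IsNCPairing i l π)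
    (hj : (i + 1, j) ∈ π) :
    ∃ π₁ π₂, IsNCPairing (i + 1) (j - 1) π₁ ∧ IsNCPairing j l π₂ ∧
      joinPairings i j π₁ π₂ = π := by
  classical
  have hb := hπ.mem_Ioc _ hj
  simp only at hb
  -- Any other block shares no endpoint with `(i + 1, j)` and does not cross it, so it lies inside
  -- or to the right.
  have key : ∀ p ∈ π, p = (i + 1, j) ∨ (i + 1 < p.1 ∧ p.2 < j) ∨ j < p.1 := by
    intro p hp
    by_cases hpe : p = (i + 1, j)
    · exact .inl hpe
    have hp' := hπ.mem_Ioc p hp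
    have n1 : p.1 ≠ i + 1 := fun h => hpe (hπ.eq_of_share hp hj (.inl h) (.inl rfl))
    have n2 : p.1 ≠ j := fun h => hpe (hπ.eq_of_share hp hj (.inl h) (.inr rfl))
    have n3 : p.2 ≠ j := fun h => hpe (hπ.eq_of_share hp hj (.inr h) (.inr rfl))
    have := hπ.noncrossing _ hj p hp
    simp only at this
    omega
  refine ⟨π.filter fun p => i + 1 < p.1 ∧ p.2 < j, π.filter fun p => j < p.1, ?_, ?_, ?_⟩
  · refine ⟨fun p hp => ?_, fun m hm hml => ?_, fun p hp q hq => ?_⟩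
    · obtain ⟨hp, h1, h2⟩ := Finset.mem_filter.1 hp
      have := hπ.mem_Ioc p hp
      omega
    · obtain ⟨p, ⟨hp, hpm⟩, hu⟩ := hπ.cover m (by omega) (by omega)
      refine ⟨p, ⟨Finset.mem_filter.2 ⟨hp, ?_⟩, hpm⟩, fun q hq => hu q
        ⟨(Finset.mem_filter.1 hq.1).1, hq.2⟩⟩
      have := hπ.mem_Ioc p hp
      rcases key p hp with rfl | h | h
      · simp only at hpm
        omega
      · exact h
      · omega
    · exact hπ.noncrossing p (Finset.mem_filter.1 hp).1 q (Finset.mem_filter.1 hq).1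
  · refine ⟨fun p hp => ?_, fun m hm hml => ?_, fun p hp q hq => ?_⟩
    · obtain ⟨hp, h1⟩ := Finset.mem_filter.1 hp
      have := hπ.mem_Ioc p hp
      omega
    · obtain ⟨p, ⟨hp, hpm⟩, hu⟩ := hπ.cover m (by omega) (by omega)
      refine ⟨p, ⟨Finset.mem_filter.2 ⟨hp, ?_⟩, hpm⟩, fun q hq => hu q
        ⟨(Finset.mem_filter.1 hq.1).1, hq.2⟩⟩
      have := hπ.mem_Ioc p hp
      rcases key p hp with rfl | h | h
      · simp only at hpm
        omega
      · omega
      · omega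
    · exact hπ.noncrossing p (Finset.mem_filter.1 hp).1 q (Finset.mem_filter.1 hq).1
  · ext p
    rw [mem_joinPairings, Finset.mem_filter, Finset.mem_filter]
    constructor
    · rintro (rfl | h | h)
      · exact hj
      · exact h.1
      · exact h.1
    · intro hp
      have := key p hp
      tauto

theorem joinPairings_injective {i j j' l : ℕ} (hij' : i + 1 < j') (hjl' : j' ≤ l) {π₁ π₂ π₁' π₂' : Finset (ℕ × ℕ)}
    (h₁ : IsNCPairing (i + 1) (j - 1) π₁) (h₂ : IsNCPairing j l π₂)
    (h₁' : IsNCPairing (i + 1) (j' - 1) π₁') (h₂' : IsNCPairing j' l π₂')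
    (h : joinPairings i j π₁ π₂ = joinPairings i j' π₁' π₂') :
    j = j' ∧ π₁ = π₁' ∧ π₂ = π₂' := by
  have hjj : j = j' := by
    have hm : (i + 1, j) ∈ joinPairings i j' π₁' π₂' := by
      rw [← h]
      exact mem_joinPairings.2 (.inl rfl)
    exact congrArg Prod.snd ((isNCPairing_joinPairings hij' hjl' h₁' h₂').eq_of_share hm
      (mem_joinPairings.2 (.inl rfl)) (m := i + 1) (.inl rfl) (.inl rfl))
  subst hjj
  have hiff : ∀ p, (p = (i + 1, j) ∨ p ∈ π₁ ∨ p ∈ π₂) ↔ (p = (i + 1, j) ∨ p ∈ π₁' ∨ p ∈ π₂') :=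
    fun p => by rw [← mem_joinPairings, ← mem_joinPairings, h]
  refine ⟨rfl, ?_, ?_⟩
  · ext p
    have hp := hiff p
    have a1 := h₁.mem_Ioc p
    have a2 := h₂.mem_Ioc p
    have a3 := h₁'.mem_Ioc p
    have a4 := h₂'.mem_Ioc p
    constructor
    · intro hm
      have := a1 hm
      rcases hp.1 (.inr (.inl hm)) with rfl | h' | h'
      · simp only at this
        omega
      · exact h'
      · have := a4 h'
        omega
    · intro hm
      have := a3 hm
      rcases hp.2 (.inr (.inl hm)) with rfl | h' | h'
      · simp only at this
        omega
      · exact h'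
      · have := a2 h'
        omega
  · ext p
    have hp := hiff p
    have a1 := h₁.mem_Ioc p
    have a2 := h₂.mem_Ioc p
    have a3 := h₁'.mem_Ioc p
    have a4 := h₂'.mem_Ioc p
    constructor
    · intro hm
      have := a2 hm
      rcases hp.1 (.inr (.inr hm)) with rfl | h' | h'
      · simp only at this
        omega
      · have := a3 h'
        omega
      · exact h'
    · intro hm
      have := a4 hm
      rcases hp.2 (.inr (.inr hm)) with rfl | h' | h'
      · simp only at this
        omega
      · have := a1 h'
        omega
      · exact h'

theorem pairingValue_joinPairings {B : Type*} [Mul B] (η : B → B) (b : ℕ → B) {i j l : ℕ}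
    (hij : i + 1 < j) (hjl : j ≤ l) {π₁ π₂ : Finset (ℕ × ℕ)}
    (h₁ : IsNCPairing (i + 1) (j - 1) π₁) (h₂ : IsNCPairing j l π₂) :
    pairingValue η (joinPairings i j π₁ π₂) b i l =
      b i * η (pairingValue η π₁ b (i + 1) (j - 1)) * pairingValue η π₂ b j l := by
  rw [(isNCPairing_joinPairings hij hjl h₁ h₂).pairingValue_eq η b
    (mem_joinPairings.2 (.inl rfl))]
  congr 1
  · congr 2
    refine pairingValue_congr η (by omega) (fun p a1 a2 a3 => ?_) fun _ _ _ => rfl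
    rw [mem_joinPairings]
    constructor
    · rintro (rfl | h | h)
      · simp at a1
      · exact h
      · have := h₂.mem_Ioc p h
        omega
    · exact fun h => .inr (.inl h)
  · refine pairingValue_congr η hjl (fun p a1 a2 a3 => ?_) fun _ _ _ => rfl
    rw [mem_joinPairings]
    constructor
    · rintro (rfl | h | h)
      · simp only at a1
        omega
      · have := h₁.mem_Ioc p h
        omega
      · exact h
    · exact fun h => .inr (.inr h)

variable {B : Type*} [Semiring B]

/-- The sum of the values of the word `b_i x_{i+1} b_{i+1} ⋯ x_l b_l` over all non-crossing
pairings of `{i + 1, …, l}`. -/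
noncomputable def pairingSum (η : B → B) (b : ℕ → B) (i l : ℕ) : B :=
  ∑ π ∈ ncPairings i l, pairingValue η π b i l

theorem ncPairings_self (i : ℕ) : ncPairings i i = {∅} := by
  ext π
  rw [mem_ncPairings, Finset.mem_singleton]
  constructor
  · intro h
    refine Finset.eq_empty_of_forall_notMem fun p hp => ?_
    have := h.mem_Ioc p hp
    omega
  · rintro rfl
    exact ⟨by simp, by omega, by simp⟩

theorem pairingSum_self (η : B → B) (b : ℕ → B) (i : ℕ) : pairingSum η b i i = b i := by
  rw [pairingSum, ncPairings_self, Finset.sum_singleton, pairingValue, dif_neg]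
  simp

/-- Pairings correspond bijectively to triples: the partner `j` of the first letter, a pairing under
that block and one to its right. -/
theorem pairingSum_eq (η : B →+ B) (b : ℕ → B) {i l : ℕ} (hil : i < l) :
    pairingSum η b i l = ∑ j ∈ Finset.Ioc (i + 1) l,
      b i * η (pairingSum η b (i + 1) (j - 1)) * pairingSum η b j l := by
  simp only [pairingSum, map_sum, Finset.mul_sum, Finset.sum_mul]
  simp_rw [Finset.sum_comm (s := ncPairings _ l), ← Finset.sum_product']
  rw [Finset.sum_sigma']
  symm
  refine Finset.sum_bij (fun x _ => joinPairings i x.1 x.2.1 x.2.2) ?_ ?_ ?_ ?_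
  · rintro ⟨j, π₁, π₂⟩ h
    simp only [Finset.mem_sigma, Finset.mem_Ioc, Finset.mem_product, mem_ncPairings] at h ⊢
    exact isNCPairing_joinPairings h.1.1 h.1.2 h.2.1 h.2.2
  · rintro ⟨j, π₁, π₂⟩ h ⟨j', π₁', π₂'⟩ h' heq
    simp only [Finset.mem_sigma, Finset.mem_Ioc, Finset.mem_product, mem_ncPairings] at h h'
    obtain ⟨rfl, rfl, rfl⟩ := joinPairings_injective h'.1.1 h'.1.2
      h.2.1 h.2.2 h'.2.1 h'.2.2 heq
    rfl
  · intro π hπ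
    rw [mem_ncPairings] at hπ
    obtain ⟨p, ⟨hp, hpm⟩, -⟩ := hπ.cover (i + 1) (by omega) (by omega)
    have hb := hπ.mem_Ioc p hp
    obtain ⟨p1, j⟩ := p
    simp only at hb hpm
    obtain rfl : p1 = i + 1 := by omega
    obtain ⟨π₁, π₂, h₁, h₂, h⟩ := exists_joinPairings_eq hπ hp
    refine ⟨⟨j, π₁, π₂⟩, ?_, h⟩
    simp only [Finset.mem_sigma, Finset.mem_Ioc, Finset.mem_product, mem_ncPairings]
    exact ⟨⟨hb.2.1, hb.2.2⟩, h₁, h₂⟩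
  · rintro ⟨j, π₁, π₂⟩ h
    simp only [Finset.mem_sigma, Finset.mem_Ioc, Finset.mem_product, mem_ncPairings] at h
    exact (pairingValue_joinPairings η b h.1.1 h.1.2 h.2.1 h.2.2).symm

theorem pairingSum_congr (η : B → B) {b b' : ℕ → B} {i l : ℕ} (hil : i ≤ l)
    (h : ∀ m, i ≤ m → m ≤ l → b m = b' m) : pairingSum η b i l = pairingSum η b' i l :=
  Finset.sum_congr rfl fun _ _ => pairingValue_congr η hil (fun _ _ _ _ => Iff.rfl) h

theorem pairingSum_mul_right (η : B →+ B) {b b' : ℕ → B} {c : B} {i l : ℕ} (hil : i ≤ l)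
    (h : ∀ m, i ≤ m → m < l → b m = b' m) (hl : b l = b' l * c) :
    pairingSum η b i l = pairingSum η b' i l * c := by
  induction hn : l - i using Nat.strong_induction_on generalizing i with
  | _ n ih =>
    rcases hil.eq_or_lt with rfl | hil
    · rw [pairingSum_self, pairingSum_self, hl]
    rw [pairingSum_eq η b hil, pairingSum_eq η b' hil, Finset.sum_mul]
    refine Finset.sum_congr rfl fun j hj => ?_
    rw [Finset.mem_Ioc] at hj
    rw [h i le_rfl hil, ih (l - j) (by omega) (by omega) (fun m _ _ => h m (by omega) (by omega)) rfl,
      pairingSum_congr η (b := b) (b' := b') (by omega) (fun m _ _ => h m (by omega) (by omega)),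
      mul_assoc _ _ c]

theorem pairingSum_mul_left (η : B →+ B) {b b' : ℕ → B} {c : B} {i l : ℕ} (hil : i < l)
    (h : ∀ m, i < m → m ≤ l → b m = b' m) (hi : b i = c * b' i) :
    pairingSum η b i l = c * pairingSum η b' i l := by
  rw [pairingSum_eq η b hil, pairingSum_eq η b' hil, Finset.mul_sum]
  refine Finset.sum_congr rfl fun j hj => ?_
  rw [Finset.mem_Ioc] at hj
  rw [hi, pairingSum_congr η (b := b) (b' := b') (by omega) (fun m _ _ => h m (by omega) (by omega)),
    pairingSum_congr η (b := b) (b' := b') (i := j) (by omega)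
      (fun m _ _ => h m (by omega) (by omega)), mul_assoc c, mul_assoc c]

/-- The sum of the values of the word `c x c x ⋯ x c` with `n` letters `x` over all non-crossing
pairings. -/
noncomputable def constPairingSum (η : B → B) (c : B) (n : ℕ) : B := pairingSum η (fun _ => c) 0 n

/-- Translation invariance, which turns the interval recursion into one indexed by length alone. -/
theorem pairingSum_const (η : B →+ B) (c : B) {i l : ℕ} (hil : i ≤ l) :
    pairingSum η (fun _ => c) i l = constPairingSum η c (l - i) := by
  induction hn : l - i using Nat.strong_induction_on generalizing i l with
  | _ n ih =>
    rcases hil.eq_or_lt with rfl | hil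
    · rw [← hn, Nat.sub_self, constPairingSum, pairingSum_self, pairingSum_self]
    rw [constPairingSum, pairingSum_eq η _ hil, pairingSum_eq η _ (by omega : 0 < n)]
    refine Finset.sum_bij (fun j _ => j - i) ?_ ?_ ?_ ?_
    · intro j hj
      rw [Finset.mem_Ioc] at hj ⊢
      omega
    · intro j hj j' hj' h
      rw [Finset.mem_Ioc] at hj hj'
      omega
    · intro j hj
      rw [Finset.mem_Ioc] at hj
      exact ⟨j + i, by rw [Finset.mem_Ioc]; omega, by omega⟩
    · intro j hj
      rw [Finset.mem_Ioc] at hj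
      rw [ih (j - 1 - (i + 1)) (by omega) (by omega) rfl, ih (l - j) (by omega) (by omega) rfl,
        ih (j - i - 1 - (0 + 1)) (by omega) (by omega) rfl,
        ih (n - (j - i)) (by omega) (by omega) rfl]
      rw [show j - i - 1 - (0 + 1) = j - 1 - (i + 1) by omega, show n - (j - i) = l - j by omega]

theorem constPairingSum_zero (η : B → B) (c : B) : constPairingSum η c 0 = c :=
  pairingSum_self _ _ _

theorem constPairingSum_one (η : B →+ B) (c : B) : constPairingSum η c 1 = 0 := by
  rw [constPairingSum, pairingSum_eq η _ one_pos]
  simp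

theorem constPairingSum_add_two (η : B →+ B) (c : B) (n : ℕ) :
    constPairingSum η c (n + 2) = ∑ p ∈ Finset.HasAntidiagonal.antidiagonal n,
      c * η (constPairingSum η c p.1) * constPairingSum η c p.2 := by
  rw [constPairingSum, pairingSum_eq η _ (by omega)]
  refine Finset.sum_bij (fun j _ => (j - 2, n + 2 - j)) ?_ ?_ ?_ ?_
  · intro j hj
    rw [Finset.mem_Ioc] at hj
    rw [Finset.HasAntidiagonal.mem_antidiagonal]
    omega
  · intro j hj j' hj' h
    rw [Finset.mem_Ioc] at hj hj'
    simp only [Prod.mk.injEq] at h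
    omega
  · rintro ⟨p, q⟩ h
    rw [Finset.HasAntidiagonal.mem_antidiagonal] at h
    simp only at h
    exact ⟨p + 2, by rw [Finset.mem_Ioc]; omega, by simp only [Prod.mk.injEq]; omega⟩
  · intro j hj
    rw [Finset.mem_Ioc] at hj
    rw [pairingSum_const η c (by omega), pairingSum_const η c (by omega)]
    congr 3

/-- `etaPi` puts `1` in the two outer slots of the word; the outer factors `c` fill them. -/
theorem mul_sum_etaPi_mul (η : B →+ B) (c : B) {k : ℕ} (hk : 1 ≤ k) :
    c * (∑ π ∈ NC2 k, etaPi η k π fun _ => c) * c = constPairingSum η c k := by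
  change c * pairingSum η (fun m => if 0 < m ∧ m < k then c else 1) 0 k * c = _
  rw [← pairingSum_mul_left η (b := fun m => if m < k then c else 1) hk,
    ← pairingSum_mul_right η (b := fun _ => c) (by omega)]
  · rfl
  · intro m _ hm
    simp [hm]
  · simp
  · intro m hm _
    simp [hm]
  · have : 0 < k := hk
    simp [this]

end Pairings
-- Uniqueness by a `2 × 2` matrix contraction
section TwoByTwo

variable {B : Type*} [CStarAlgebra B]

/-- The `2 × 2` matrix with the given entries, as an element of a C⋆-algebra. -/
def twoByTwo (a x y d : B) : CStarMatrix (Fin 2) (Fin 2) B := CStarMatrix.ofMatrix !![a, x; y, d]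

theorem twoByTwo_mul (a x y d a' x' y' d' : B) :
    twoByTwo a x y d * twoByTwo a' x' y' d' =
      twoByTwo (a * a' + x * y') (a * x' + x * d') (y * a' + d * y') (y * x' + d * d') := by
  ext i j
  rw [CStarMatrix.mul_apply, Fin.sum_univ_two]
  fin_cases i <;> fin_cases j <;> rfl

theorem star_twoByTwo (a x y d : B) :
    star (twoByTwo a x y d) = twoByTwo (star a) (star y) (star x) (star d) := by
  ext i j
  rw [CStarMatrix.star_apply]
  fin_cases i <;> fin_cases j <;> rfl

theorem twoByTwo_add (a x y d a' x' y' d' : B) :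
    twoByTwo a x y d + twoByTwo a' x' y' d' =
      twoByTwo (a + a') (x + x') (y + y') (d + d') := by
  ext i j
  fin_cases i <;> fin_cases j <;> rfl

omit [CStarAlgebra B] in
theorem twoByTwo_smul {R : Type*} [SMul R B] (c : R) (a x y d : B) :
    c • twoByTwo a x y d = twoByTwo (c • a) (c • x) (c • y) (c • d) := by
  ext i j
  fin_cases i <;> fin_cases j <;> rfl

omit [CStarAlgebra B] in
theorem twoByTwo_map (η : B → B) (a x y d : B) :
    (twoByTwo a x y d).map η = twoByTwo (η a) (η x) (η y) (η d) := by
  ext i j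
  fin_cases i <;> fin_cases j <;> rfl

theorem one_eq_twoByTwo : (1 : CStarMatrix (Fin 2) (Fin 2) B) = twoByTwo 1 0 0 1 := by
  ext i j
  fin_cases i <;> fin_cases j <;> rfl

theorem nonneg_add_norm_smul_one {C : Type*} [CStarAlgebra C] [PartialOrder C] [StarOrderedRing C]
    {a : C} (ha : IsSelfAdjoint a) : 0 ≤ a + (‖a‖ : ℂ) • (1 : C) := by
  have h := ha.neg_algebraMap_norm_le_self
  rwa [neg_le_iff_add_nonneg, Algebra.algebraMap_eq_smul_one, ← Complex.coe_smul] at h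

variable [PartialOrder B] [StarOrderedRing B]

theorem twoByTwo_diag_nonneg {p d : B} (hp : 0 ≤ p) (hd : 0 ≤ d) : 0 ≤ twoByTwo p 0 0 d := by
  have h := star_mul_self_nonneg (twoByTwo (CFC.sqrt p) 0 0 (CFC.sqrt d))
  rw [star_twoByTwo, twoByTwo_mul, (CFC.sqrt_nonneg p).star_eq, (CFC.sqrt_nonneg d).star_eq,
    CFC.sqrt_mul_sqrt_self p, CFC.sqrt_mul_sqrt_self d] at h
  simpa using h

theorem twoByTwo_nonneg_of_le {a x y d a' d' : B} (h : 0 ≤ twoByTwo a x y d) (ha : a ≤ a')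
    (hd : d ≤ d') : 0 ≤ twoByTwo a' x y d' := by
  have := add_nonneg h (twoByTwo_diag_nonneg (sub_nonneg.2 ha) (sub_nonneg.2 hd))
  rw [twoByTwo_add] at this
  simpa using this

/-- The off-diagonal matrix is self-adjoint, hence nonnegative after adding its norm times `1`; each
diagonal entry is then dominated by a multiple of `vᵢ`. -/
theorem exists_smul_twoByTwo_nonneg {v₁ v₂ : B} (h₁ : IsStrictlyPositive v₁)
    (h₂ : IsStrictlyPositive v₂) (x : B) :
    ∃ c : ℝ, 0 ≤ twoByTwo (c • v₁) x (star x) (c • v₂) := by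
  obtain ⟨ε₁, hε₁, h₁⟩ := exists_smul_one_le h₁
  obtain ⟨ε₂, hε₂, h₂⟩ := exists_smul_one_le h₂
  set r := ‖twoByTwo 0 x (star x) 0‖
  have hr : 0 ≤ r := norm_nonneg _
  have hsa : IsSelfAdjoint (twoByTwo 0 x (star x) 0) := by
    rw [IsSelfAdjoint, star_twoByTwo]
    simp
  have h := nonneg_add_norm_smul_one hsa
  rw [one_eq_twoByTwo, twoByTwo_smul, twoByTwo_add] at h
  simp only [smul_zero, add_zero, zero_add, Complex.coe_smul] at h
  have key : ∀ {ε : ℝ} {v : B}, 0 < ε → min ε₁ ε₂ ≤ ε → ε • (1 : B) ≤ v →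
      r • (1 : B) ≤ (r / min ε₁ ε₂) • v := by
    intro ε v hε hm hv
    have hmin : 0 < min ε₁ ε₂ := lt_min hε₁ hε₂
    calc r • (1 : B) = (r / min ε₁ ε₂) • (min ε₁ ε₂ • (1 : B)) := by
          rw [smul_smul, div_mul_cancel₀ _ hmin.ne']
      _ ≤ (r / min ε₁ ε₂) • (ε • (1 : B)) := by gcongr
      _ ≤ _ := by gcongr
  exact ⟨r / min ε₁ ε₂, twoByTwo_nonneg_of_le h (key hε₁ (min_le_left _ _) h₁)
    (key hε₂ (min_le_right _ _) h₂)⟩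

/-- Conjugation by `diag(1, -1)` changes the sign of the matrix, which is therefore both `≥ 0` and
`≤ 0`. -/
theorem eq_zero_of_twoByTwo_nonneg {x : B} (h : 0 ≤ twoByTwo 0 x (star x) 0) : x = 0 := by
  have h1 := star_left_conjugate_nonneg h (twoByTwo 1 0 0 (-1))
  rw [star_twoByTwo, twoByTwo_mul, twoByTwo_mul] at h1
  have h3 : twoByTwo 0 x (star x) 0 = 0 := by
    refine le_antisymm ?_ h
    refine neg_nonneg.1 (le_of_le_of_eq h1 ?_)
    ext i j
    fin_cases i <;> fin_cases j <;> simp [twoByTwo]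
  exact congrFun (congrFun h3 0) 1

/-- Apply `η` entrywise, then conjugate by `diag(w₁*, w₂)`: the off-diagonal `x` is fixed and the
diagonal shrinks by the factor `r`. The limit is covered by `eq_zero_of_twoByTwo_nonneg`. -/
theorem eq_zero_of_eq_mul_map_mul (η : B →CP B) {w₁ w₂ v₁ v₂ x : B} {r : ℝ} (hr0 : 0 ≤ r)
    (hr1 : r < 1) (hv₁ : IsStrictlyPositive v₁) (hv₂ : IsStrictlyPositive v₂)
    (h₁ : w₁ * η v₁ * star w₁ ≤ r • v₁) (h₂ : star w₂ * η v₂ * w₂ ≤ r • v₂)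
    (hx : x = w₁ * η x * w₂) : x = 0 := by
  obtain ⟨c, hc⟩ := exists_smul_twoByTwo_nonneg hv₁ hv₂ x
  wlog hc0 : 0 ≤ c generalizing c
  · refine this 0 (twoByTwo_nonneg_of_le hc ?_ ?_) le_rfl
    · exact smul_le_smul_of_nonneg_right (not_le.1 hc0).le hv₁.nonneg
    · exact smul_le_smul_of_nonneg_right (not_le.1 hc0).le hv₂.nonneg
  have hstep : ∀ t : ℝ, 0 ≤ t → 0 ≤ twoByTwo (t • v₁) x (star x) (t • v₂) →
      0 ≤ twoByTwo ((r * t) • v₁) x (star x) ((r * t) • v₂) := by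
    intro t ht h
    have h' := η.map_cstarMatrix_nonneg _ h
    rw [twoByTwo_map] at h'
    have h3 := star_left_conjugate_nonneg h' (twoByTwo (star w₁) 0 0 w₂)
    rw [star_twoByTwo, twoByTwo_mul, twoByTwo_mul] at h3
    have hsx : star x = star w₂ * η (star x) * star w₁ := by
      conv_lhs => rw [hx]
      rw [map_star, star_mul, star_mul, mul_assoc]
    simp only [star_zero, star_star, zero_mul, mul_zero, add_zero, zero_add] at h3
    rw [← hx, ← hsx] at h3
    have hηs : ∀ v, η (t • v) = t • η v := fun v => by
      rw [← Complex.coe_smul, map_smul, Complex.coe_smul]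
    refine twoByTwo_nonneg_of_le h3 ?_ ?_
    · rw [hηs, mul_smul_comm, smul_mul_assoc, mul_comm, mul_smul]
      gcongr
    · rw [hηs, mul_smul_comm, smul_mul_assoc, mul_comm, mul_smul]
      gcongr
  have hall : ∀ n : ℕ, 0 ≤ twoByTwo ((r ^ n * c) • v₁) x (star x) ((r ^ n * c) • v₂) := by
    intro n
    induction n with
    | zero => simpa using hc
    | succ n ih =>
      have := hstep _ (by positivity) ih
      rwa [← mul_assoc, ← pow_succ'] at this
  apply eq_zero_of_twoByTwo_nonneg
  have hlim : Filter.Tendsto (fun n : ℕ => (r ^ n * c) • twoByTwo v₁ 0 0 v₂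
      + twoByTwo 0 x (star x) 0) Filter.atTop (nhds (twoByTwo 0 x (star x) 0)) := by
    have h0 : Filter.Tendsto (fun n : ℕ => r ^ n * c) Filter.atTop (nhds 0) := by
      simpa using (tendsto_pow_atTop_nhds_zero_of_lt_one hr0 hr1).mul_const c
    simpa using (h0.smul_const (twoByTwo v₁ 0 0 v₂)).add_const (twoByTwo 0 x (star x) 0)
  refine CStarAlgebra.isClosed_nonneg.mem_of_tendsto hlim (Filter.Eventually.of_forall fun n => ?_)
  have := hall n
  rw [twoByTwo_smul, twoByTwo_add]
  simpa using this

/-- The solution in the lower half-plane of `w⁻¹ = b - η(w)` is unique. -/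
theorem eq_of_mul_eq_one_add (η : B →CP B) {b w₁ w₂ : B} (hb : b ∈ upperHalfPlane B)
    (hw₁ : w₁ ∈ lowerHalfPlane B) (hw₂ : w₂ ∈ lowerHalfPlane B)
    (h₁ : b * w₁ = 1 + η w₁ * w₁) (h₂ : b * w₂ = 1 + η w₂ * w₂) : w₁ = w₂ := by
  have hinv : ∀ w ∈ lowerHalfPlane B, b * w = 1 + η w * w →
      (b - η w) * w = 1 ∧ w * (b - η w) = 1 := by
    intro w hw h
    have h3 : (b - η w) * w = 1 := by rw [sub_mul, h]; abel
    have hu := isUnit_of_mem_lowerHalfPlane hw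
    refine ⟨h3, ?_⟩
    rw [← Ring.mul_inverse_cancel w hu]
    congr 1
    rw [← mul_one (b - η w), ← Ring.mul_inverse_cancel w hu, ← mul_assoc, h3, one_mul]
  have hbpos := mem_upperHalfPlane_iff.1 hb
  have him : ∀ w, (ℑ (b - η w) : B) = ℑ b + η (-(ℑ w : B)) := by
    intro w
    have : (ℑ (η w) : B) = η (ℑ w : B) := by
      simp only [imaginaryPart_apply_coe]
      rw [← Complex.coe_smul, ← Complex.coe_smul]
      simp only [map_smul, map_sub, map_star]
    rw [map_sub, AddSubgroupClass.coe_sub, this, map_neg, sub_eq_add_neg]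
  -- Strictness comes from `Im b`: with `y* (Im b) y ≥ ε` and `v ≤ ‖v‖ + ε`, the part of `v` due to
  -- `z` is at most `(1 - ε / (‖v‖ + ε)) v`.
  have hkey : ∀ {y v z : B}, v = star y * ((ℑ b : B) + z) * y → IsUnit y →
      ∃ r : ℝ, 0 ≤ r ∧ r < 1 ∧ ∀ r', r ≤ r' → 0 ≤ v → star y * z * y ≤ r' • v := by
    intro y v z hv hy
    have hp : IsStrictlyPositive (star y * (ℑ b : B) * y) :=
      ⟨star_left_conjugate_nonneg hbpos.nonneg _, (hy.star.mul hbpos.isUnit).mul hy⟩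
    obtain ⟨ε, hε, hle⟩ := exists_smul_one_le hp
    refine ⟨1 - (ε / (‖v‖ + ε)), ?_, ?_, fun r' hr' hv0 => ?_⟩
    · rw [sub_nonneg, div_le_one (by positivity)]
      linarith [norm_nonneg v]
    · have : 0 < ε / (‖v‖ + ε) := by positivity
      linarith
    · have h4 : (ε / (‖v‖ + ε)) • v ≤ star y * (ℑ b : B) * y := by
        refine le_trans ?_ hle
        have h5 : v ≤ (‖v‖ + ε) • (1 : B) := by
          refine (IsSelfAdjoint.le_algebraMap_norm_self hv0.isSelfAdjoint).trans ?_
          rw [Algebra.algebraMap_eq_smul_one]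
          have : (0 : B) ≤ 1 := zero_le_one
          gcongr
          linarith
        calc (ε / (‖v‖ + ε)) • v ≤ (ε / (‖v‖ + ε)) • ((‖v‖ + ε) • (1 : B)) := by gcongr
          _ = ε • (1 : B) := by
            rw [smul_smul, div_mul_cancel₀]
            positivity
      calc star y * z * y = v - star y * (ℑ b : B) * y := by
            rw [hv]; noncomm_ring
        _ ≤ v - (ε / (‖v‖ + ε)) • v := by gcongr
        _ = (1 - ε / (‖v‖ + ε)) • v := by rw [sub_smul, one_smul]
        _ ≤ r' • v := by gcongr
  obtain ⟨l₁, u₁⟩ := hinv w₁ hw₁ h₁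
  obtain ⟨l₂, u₂⟩ := hinv w₂ hw₂ h₂
  have e₁ := neg_imaginaryPart_eq_conj_star u₁
  have e₂ := neg_imaginaryPart_eq_star_conj l₂
  rw [him] at e₁ e₂
  have p₁ := mem_lowerHalfPlane_iff.1 hw₁
  have p₂ := mem_lowerHalfPlane_iff.1 hw₂
  have n₁ := isUnit_of_mem_lowerHalfPlane hw₁
  have n₂ := isUnit_of_mem_lowerHalfPlane hw₂
  obtain ⟨r₁, ra₁, rb₁, rc₁⟩ := hkey (y := star w₁) (v := -(ℑ w₁ : B)) (z := η (-(ℑ w₁ : B)))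
    (by rwa [star_star]) n₁.star
  obtain ⟨r₂, ra₂, rb₂, rc₂⟩ := hkey e₂ n₂
  rw [← sub_eq_zero]
  refine eq_zero_of_eq_mul_map_mul η (w₁ := w₁) (r := max r₁ r₂) (ra₁.trans (le_max_left _ _))
    (max_lt rb₁ rb₂) p₁ p₂ ?_ (rc₂ _ (le_max_right _ _) p₂.nonneg) ?_
  · have := rc₁ _ (le_max_left _ r₂) p₁.nonneg
    rwa [star_star] at this
  -- Since `wᵢ⁻¹ = b - η(wᵢ)`, this is `w₁ - w₂ = w₁ (w₂⁻¹ - w₁⁻¹) w₂`.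
  · have : η (w₁ - w₂) = (b - η w₂) - (b - η w₁) := by rw [map_sub]; abel
    rw [this, mul_sub, sub_mul, u₁, mul_assoc, l₂]
    simp

end TwoByTwo
-- Conditional expectation, Cauchy transform and states
namespace OpValuedCStarProbSpace

variable {A B : Type*} [CStarAlgebra A] [CStarAlgebra B] [PartialOrder B] [StarOrderedRing B]
  (P : OpValuedCStarProbSpace A B)

omit [StarOrderedRing B] in
theorem E_one : P.E 1 = 1 := by
  rw [← map_one P.ι, P.E_ι]

section Order

variable [PartialOrder A] [StarOrderedRing A]

/-- The conditional expectation as a positive map. -/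
noncomputable def posE : A →ₚ[ℂ] B := PositiveLinearMap.mk₀ P.E fun x hx => by
  have h := P.E_nonneg (CFC.sqrt x)
  rwa [(CFC.sqrt_nonneg x).star_eq, CFC.sqrt_mul_sqrt_self x] at h

theorem E_mono {x y : A} (h : x ≤ y) : P.E x ≤ P.E y := OrderHomClass.mono P.posE h

theorem E_star' (x : A) : P.E (star x) = star (P.E x) := map_star P.posE x

/-- Kadison–Schwarz: expand `E[(x - E x)* (x - E x)] ≥ 0` with the bimodule property. -/
theorem star_E_mul_E_le' (x : A) : star (P.E x) * P.E x ≤ P.E (star x * x) := by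
  have h := P.E_nonneg (x - P.ι (P.E x))
  have e1 : P.E (star x * P.ι (P.E x)) = star (P.E x) * P.E x := by
    have := P.E_bimodule 1 (star x) (P.E x)
    rwa [map_one, one_mul, one_mul, P.E_star'] at this
  have e2 : P.E (P.ι (star (P.E x)) * x) = star (P.E x) * P.E x := by
    have := P.E_bimodule (star (P.E x)) x 1
    rwa [map_one, mul_one, mul_one] at this
  rw [star_sub, sub_mul, mul_sub, mul_sub, map_sub, map_sub, map_sub, e1, ← map_star P.ι, e2,
    ← map_mul, P.E_ι, sub_self, sub_zero, sub_nonneg] at h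
  exact h

theorem norm_E_le' (x : A) : ‖P.E x‖ ≤ ‖x‖ := by
  have h := P.star_E_mul_E_le' x
  have h2 : P.E (star x * x) ≤ (‖x‖ ^ 2) • (1 : B) := by
    refine (P.E_mono CStarAlgebra.star_mul_le_algebraMap_norm_sq).trans (le_of_eq ?_)
    rw [Algebra.algebraMap_eq_smul_one, ← Complex.coe_smul, map_smul, Complex.coe_smul, P.E_one]
  have h3 : ‖star (P.E x) * P.E x‖ ≤ ‖x‖ ^ 2 := by
    rw [CStarAlgebra.norm_le_iff_le_algebraMap _ (by positivity) (star_mul_self_nonneg _),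
      Algebra.algebraMap_eq_smul_one]
    exact h.trans h2
  rw [CStarRing.norm_star_mul_self, ← sq] at h3
  exact (sq_le_sq₀ (norm_nonneg _) (norm_nonneg _)).1 h3

end Order

theorem E_star (x : A) : P.E (star x) = star (P.E x) := by
  -- `A` carries no order in the statement; its spectral order is used locally.
  let _ := CStarAlgebra.spectralOrder A
  have _ := CStarAlgebra.spectralOrderedRing A
  exact P.E_star' x

theorem norm_E_le (x : A) : ‖P.E x‖ ≤ ‖x‖ := by
  let _ := CStarAlgebra.spectralOrder A
  have _ := CStarAlgebra.spectralOrderedRing A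
  exact P.norm_E_le' x

/-- The conditional expectation as a continuous linear map. -/
noncomputable def clmE : A →L[ℂ] B :=
  P.E.mkContinuous 1 fun x => by simpa using P.norm_E_le x

theorem imaginaryPart_E (x : A) : (ℑ (P.E x) : B) = P.E (ℑ x : A) := by
  simp only [imaginaryPart_apply_coe]
  rw [← Complex.coe_smul, ← Complex.coe_smul]
  simp only [map_smul, map_sub, P.E_star]

omit [StarOrderedRing B] in
theorem imaginaryPart_ι (b : B) : (ℑ (P.ι b) : A) = P.ι (ℑ b : B) := by
  simp only [imaginaryPart_apply_coe]
  rw [← Complex.coe_smul, ← Complex.coe_smul]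
  simp only [map_smul, map_sub, map_star]

omit [StarOrderedRing B] in
theorem imaginaryPart_ι_sub {s : A} (hs : IsSelfAdjoint s) (b : B) :
    (ℑ (P.ι b - s) : A) = P.ι (ℑ b : B) := by
  rw [map_sub, hs.imaginaryPart, sub_zero, P.imaginaryPart_ι]

theorem smul_one_le_imaginaryPart_ι_sub [PartialOrder A] [StarOrderedRing A] {s : A}
    (hs : IsSelfAdjoint s) {b : B} {ε : ℝ} (h : ε • (1 : B) ≤ (ℑ b : B)) :
    ε • (1 : A) ≤ (ℑ (P.ι b - s) : A) := by
  rw [P.imaginaryPart_ι_sub hs]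
  have := OrderHomClass.mono P.ι h
  rwa [← Complex.coe_smul, map_smul, map_one, Complex.coe_smul] at this

theorem isUnit_ι_sub {s : A} (hs : IsSelfAdjoint s) {b : B} (hb : b ∈ upperHalfPlane B) :
    IsUnit (P.ι b - s) := by
  let _ := CStarAlgebra.spectralOrder A
  have _ := CStarAlgebra.spectralOrderedRing A
  obtain ⟨ε, hε, h⟩ := hb
  exact isUnit_of_mem_upperHalfPlane ⟨ε, hε, P.smul_one_le_imaginaryPart_ι_sub hs h⟩

theorem norm_inverse_ι_sub_le {s : A} (hs : IsSelfAdjoint s) {b : B} {ε : ℝ} (hε : 0 < ε)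
    (h : ε • (1 : B) ≤ (ℑ b : B)) : ‖Ring.inverse (P.ι b - s)‖ ≤ ε⁻¹ := by
  let _ := CStarAlgebra.spectralOrder A
  have _ := CStarAlgebra.spectralOrderedRing A
  exact norm_inverse_le_of_smul_one_le_imaginaryPart hε (P.smul_one_le_imaginaryPart_ι_sub hs h)

theorem cauchyTransform_mem_lowerHalfPlane {s : A} (hs : IsSelfAdjoint s) {b : B}
    (hb : b ∈ upperHalfPlane B) : P.cauchyTransform s b ∈ lowerHalfPlane B := by
  let _ := CStarAlgebra.spectralOrder A
  have _ := CStarAlgebra.spectralOrderedRing A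
  obtain ⟨ε, hε, h⟩ := hb
  obtain ⟨δ, hδ, hle⟩ := exists_smul_one_le (isStrictlyPositive_neg_imaginaryPart_inverse
    (isStrictlyPositive_of_smul_one_le hε (P.smul_one_le_imaginaryPart_ι_sub hs h)))
  refine ⟨δ, hδ, ?_⟩
  rw [cauchyTransform, P.imaginaryPart_E, ← map_neg]
  have := P.E_mono hle
  rwa [← Complex.coe_smul, map_smul, P.E_one, Complex.coe_smul] at this

omit [StarOrderedRing B] in
theorem cauchyTransform_sub_cauchyTransform {s : A} {b b' : B} (hb : IsUnit (P.ι b - s))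
    (hb' : IsUnit (P.ι b' - s)) :
    P.cauchyTransform s b' - P.cauchyTransform s b =
      P.E (Ring.inverse (P.ι b' - s) * P.ι (b - b') * Ring.inverse (P.ι b - s)) := by
  have h : P.ι (b - b') = (P.ι b - s) - (P.ι b' - s) := by rw [map_sub]; abel
  rw [h, mul_sub, sub_mul, Ring.inverse_mul_cancel _ hb', Ring.mul_inverse_cancel_right _ _ hb,
    one_mul, map_sub, cauchyTransform, cauchyTransform]

/-- A state on `B` composed with the conditional expectation, as a positive functional. -/
noncomputable def stateE [PartialOrder A] [StarOrderedRing A] {φ : B →L[ℂ] ℂ} (hφ : IsState φ) : A →ₚ[ℂ] ℂ :=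
  PositiveLinearMap.mk₀ (φ.toLinearMap ∘ₗ P.E) fun x hx => by
    have h : 0 ≤ P.E x := P.posE.map_nonneg hx
    have h2 := hφ.nonneg (CFC.sqrt (P.E x))
    rwa [(CFC.sqrt_nonneg _).star_eq, CFC.sqrt_mul_sqrt_self (P.E x)] at h2

/-- Cauchy–Schwarz in the pre-GNS space of `φ ∘ E`, together with `x x* ≤ ‖x‖²` and `φ(1) ≤ 1` in
real part. -/
theorem norm_state_E_mul_le {φ : B →L[ℂ] ℂ} (hφ : IsState φ) (x y : A) :
    ‖φ (P.E (x * y))‖ ≤ ‖x‖ * √(φ (P.E (star y * y))).re := by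
  let _ := CStarAlgebra.spectralOrder A
  have _ := CStarAlgebra.spectralOrderedRing A
  set f := P.stateE hφ with hf
  have hcs := norm_inner_le_norm (𝕜 := ℂ) (f.toPreGNS (star x)) (f.toPreGNS y)
  rw [PositiveLinearMap.preGNS_inner_def, PositiveLinearMap.preGNS_norm_def,
    PositiveLinearMap.preGNS_norm_def] at hcs
  simp only [PositiveLinearMap.ofPreGNS_toPreGNS, star_star] at hcs
  refine hcs.trans ?_
  refine mul_le_mul_of_nonneg_right ?_ (Real.sqrt_nonneg _)
  refine Real.sqrt_le_iff.2 ⟨norm_nonneg _, ?_⟩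
  have h1 : f (x * star x) ≤ f (algebraMap ℝ A (‖x‖ ^ 2)) :=
    OrderHomClass.mono f CStarAlgebra.mul_star_le_algebraMap_norm_sq
  rw [Algebra.algebraMap_eq_smul_one, ← Complex.coe_smul, map_smul] at h1
  have h2 : (f 1).re ≤ 1 := by
    have h3 : f 1 = φ 1 := congrArg φ P.E_one
    rw [h3]
    calc (φ 1).re ≤ ‖φ 1‖ := Complex.re_le_norm _
      _ ≤ ‖φ‖ * ‖(1 : B)‖ := φ.le_opNorm 1
      _ ≤ 1 := by
        rw [hφ.norm_eq_one, one_mul]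
        nontriviality B
        exact CStarRing.norm_one.le
  have h4 := (Complex.le_def.1 h1).1
  rw [smul_eq_mul, Complex.re_ofReal_mul] at h4
  nlinarith [sq_nonneg ‖x‖]

theorem state_E_star_inverse_mul_inverse_le {φ : B →L[ℂ] ℂ} (hφ : IsState φ) {s : A}
    (hs : IsSelfAdjoint s) {b : B} {κ : ℝ} (hκ : 0 < κ) (h : κ • (1 : B) ≤ (ℑ b : B)) :
    κ * (φ (P.E (star (Ring.inverse (P.ι b - s)) * Ring.inverse (P.ι b - s)))).re ≤
      -(φ (P.cauchyTransform s b)).im := by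
  let _ := CStarAlgebra.spectralOrder A
  have _ := CStarAlgebra.spectralOrderedRing A
  have hu := P.isUnit_ι_sub hs ⟨κ, hκ, h⟩
  have h1 := P.smul_one_le_imaginaryPart_ι_sub hs h
  rw [cauchyTransform]
  set y := Ring.inverse (P.ι b - s)
  have h2 := neg_imaginaryPart_eq_star_conj (Ring.mul_inverse_cancel _ hu)
  have h3 : (κ : ℂ) • (star y * y) ≤ -(ℑ y : A) := by
    rw [h2]
    have := star_left_conjugate_le_conjugate h1 y
    rw [← Complex.coe_smul] at this
    simpa using this
  set f := P.stateE hφ with hf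
  have h4 : f ((κ : ℂ) • (star y * y)) ≤ f (-(ℑ y : A)) := OrderHomClass.mono f h3
  rw [map_smul, map_neg] at h4
  have h5 := (Complex.le_def.1 h4).1
  rw [smul_eq_mul, Complex.re_ofReal_mul, Complex.neg_re] at h5
  have h6 : (f (ℑ y : A)).re = (f y).im := by
    rw [imaginaryPart_apply_coe, ← Complex.coe_smul, map_smul, map_smul, map_sub, map_star]
    simp
    ring
  rw [h6] at h5
  exact h5

end OpValuedCStarProbSpace

/-! ### The quadratic equation for the Cauchy transform -/

theorem word_const_mul {A : Type*} [Monoid A] (s c : A) (n : ℕ) :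
    word s (n + 1) (fun _ => c) * c = (s * c) ^ (n + 1) := by
  rw [word, Nat.add_sub_cancel, List.map_const', List.length_range, List.prod_replicate]
  rw [← mul_pow_mul, mul_assoc, pow_succ]

namespace OpValuedCStarProbSpace

variable {A B : Type*} [CStarAlgebra A] [CStarAlgebra B] [PartialOrder B] [StarOrderedRing B]
  {P : OpValuedCStarProbSpace A B} {s : A} {η : B →CP B}

theorem IsCenteredSemicircular.E_mul_pow (hs : P.IsCenteredSemicircular s η) (c : B) (n : ℕ) :
    P.E (P.ι c * (s * P.ι c) ^ n) = constPairingSum η c n := by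
  cases n with
  | zero => rw [pow_zero, mul_one, P.E_ι, constPairingSum_zero]
  | succ n =>
    rw [← word_const_mul, ← mul_assoc, P.E_bimodule, hs.moments _ (by omega) fun _ => c]
    exact mul_sum_etaPi_mul (η : B →+ B) c (by omega)

/-- The Neumann series writes `G` as the sum of the `constPairingSum η c n`, and the recursion over
antidiagonals is the Cauchy product of the series of `η(G)` and `G`. -/
theorem IsCenteredSemicircular.equation_of_norm_lt (hs : P.IsCenteredSemicircular s η) {b : B}
    (hb : IsUnit b) (hlt : ‖s * P.ι (Ring.inverse b)‖ < 1) :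
    b * P.cauchyTransform s b =
      1 + η (P.cauchyTransform s b) * P.cauchyTransform s b := by
  set c := Ring.inverse b with hc
  set t := s * P.ι c with ht
  set m := constPairingSum η c with hm
  have hbc : b * c = 1 := Ring.mul_inverse_cancel b hb
  have hcb : c * b = 1 := Ring.inverse_mul_cancel b hb
  have hsum : Summable fun n : ℕ => t ^ n := summable_geometric_of_norm_lt_one hlt
  have hfac : P.ι b - s = (1 - t) * P.ι b := by
    rw [sub_mul, one_mul, ht, mul_assoc, ← map_mul, hcb, map_one, mul_one]
  have hy : Ring.inverse (P.ι b - s) = P.ι c * ∑' n : ℕ, t ^ n := by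
    have h1 : (P.ι b - s) * (P.ι c * ∑' n : ℕ, t ^ n) = 1 := by
      rw [hfac, mul_assoc, ← mul_assoc (P.ι b), ← map_mul, hbc, map_one, one_mul,
        mul_neg_geom_series t hlt]
    have h2 : (P.ι c * ∑' n : ℕ, t ^ n) * (P.ι b - s) = 1 := by
      rw [hfac, mul_assoc, ← mul_assoc (∑' n : ℕ, t ^ n), geom_series_mul_neg t hlt, one_mul,
        ← map_mul, hcb, map_one]
    exact Ring.inverse_unit ⟨_, _, h1, h2⟩
  have hG : HasSum m (P.cauchyTransform s b) := by
    rw [cauchyTransform, hy]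
    have := P.clmE.hasSum (hsum.hasSum.mul_left (P.ι c))
    convert! this using 2 with n
    exact (hs.E_mul_pow c n).symm
  have hnorm : Summable fun n => ‖m n‖ := by
    refine Summable.of_nonneg_of_le (fun _ => norm_nonneg _) (fun n => ?_)
      ((summable_geometric_of_lt_one (norm_nonneg t) hlt).mul_left ‖P.ι c‖)
    rw [hm, ← hs.E_mul_pow c n]
    refine (P.norm_E_le _).trans ((norm_mul_le _ _).trans ?_)
    gcongr
    cases n with
    | zero =>
      rw [pow_zero, pow_zero]
      nontriviality A
      exact CStarRing.norm_one.le
    | succ n => exact norm_pow_le' t n.succ_pos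
  let ηL : B →L[ℂ] B := ⟨η.toLinearMap, map_continuous η⟩
  have hη : ∀ x, ηL x = η x := fun _ => rfl
  have hηnorm : Summable fun n => ‖ηL (m n)‖ :=
    Summable.of_nonneg_of_le (fun _ => norm_nonneg _) (fun n => ηL.le_opNorm _)
      (hnorm.mul_left ‖ηL‖)
  have hprod := tsum_mul_tsum_eq_tsum_sum_antidiagonal_of_summable_norm hηnorm hnorm
  have hGη := ηL.hasSum hG
  set G := P.cauchyTransform s b
  rw [hGη.tsum_eq, hG.tsum_eq, hη] at hprod
  -- The terms of index `0` and `1` are `c` and `0`; the tail sums to `c η(G) G`.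
  have h2 := hG.summable.sum_add_tsum_nat_add 2
  rw [hG.tsum_eq, Finset.sum_range_succ, Finset.sum_range_one] at h2
  have e0 : m 0 = c := constPairingSum_zero _ _
  have e1 : m 1 = 0 := constPairingSum_one (η : B →+ B) c
  have e2 : ∀ n, m (n + 2) = c * ∑ p ∈ Finset.HasAntidiagonal.antidiagonal n,
      ηL (m p.1) * m p.2 := by
    intro n
    rw [Finset.mul_sum]
    refine (constPairingSum_add_two (η : B →+ B) c n).trans (Finset.sum_congr rfl fun p _ => ?_)
    rw [mul_assoc]
    rfl
  have hsumm := (summable_norm_sum_mul_antidiagonal_of_summable_norm hηnorm hnorm).of_norm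
  simp_rw [e2] at h2
  rw [hsumm.tsum_mul_left, ← hprod, e0, e1, add_zero] at h2
  rw [← h2, mul_add, ← mul_assoc, hbc, one_mul, h2]

theorem smul_one_le_imaginaryPart_add {b : B} {ε : ℝ} (h : ε • (1 : B) ≤ (ℑ b : B)) (z : ℂ) :
    (ε + z.im) • (1 : B) ≤ (ℑ (b + z • (1 : B)) : B) := by
  have : (ℑ (z • (1 : B)) : B) = z.im • (1 : B) := by
    rw [imaginaryPart_smul]
    simp
  rw [map_add, AddSubgroup.coe_add, this, add_smul]
  gcongr

/-- The Cauchy transform of a semicircular element solves the operator-valued quadratic equation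
`b G = 1 + η(G) G` on the whole upper half-plane. -/
theorem IsCenteredSemicircular.equation (hs : P.IsCenteredSemicircular s η) {b : B}
    (hb : b ∈ upperHalfPlane B) :
    b * P.cauchyTransform s b =
      1 + η (P.cauchyTransform s b) * P.cauchyTransform s b := by
  obtain ⟨ε, hε, hle⟩ := hb
  -- Exactly the shifts for which `Im(b) ≥ ε` still guarantees `Im(b + z 1) > 0`; `U` contains `0`
  -- and is connected.
  set U : Set ℂ := {z | -ε < z.im}
  have hUo : IsOpen U := isOpen_lt continuous_const Complex.continuous_im
  have hUc : IsPreconnected U := (convex_halfSpace_im_gt (-ε)).isPreconnected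
  have hmem : ∀ z ∈ U, b + z • (1 : B) ∈ upperHalfPlane B := fun z hz =>
    ⟨ε + z.im, by simp only [U, Set.mem_ofPred_eq] at hz; linarith,
      smul_one_le_imaginaryPart_add hle z⟩
  let g : ℂ → B := fun z => P.cauchyTransform s (b + z • (1 : B))
  let ηL : B →L[ℂ] B := ⟨η.toLinearMap, map_continuous η⟩
  let h : ℂ → B := fun z => (b + z • (1 : B)) * g z - 1 - ηL (g z) * g z
  have hlin : Differentiable ℂ fun z : ℂ => b + z • (1 : B) :=
    (differentiable_id.smul_const (1 : B)).const_add b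
  have hg : DifferentiableOn ℂ g U := by
    intro z hz
    have hu := P.isUnit_ι_sub hs.isSelfAdjoint (hmem z hz)
    have h1 : DifferentiableAt ℂ (fun z : ℂ => P.ι (b + z • (1 : B)) - s) z := by
      have : (fun z : ℂ => P.ι (b + z • (1 : B)) - s) = fun z : ℂ => P.ι b + z • (1 : A) - s := by
        funext z
        rw [map_add, map_smul, map_one]
      rw [this]
      exact ((differentiableAt_id.smul_const (1 : A)).const_add (P.ι b)).sub_const s
    have h2 := (differentiableAt_inverse (𝕜 := ℂ) hu).comp z h1
    exact (P.clmE.differentiableAt.comp z h2).differentiableWithinAt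
  have hh : DifferentiableOn ℂ h U :=
    ((hlin.differentiableOn.mul hg).sub_const 1).sub
      ((ηL.differentiable.comp_differentiableOn hg).mul hg)
  -- Here `‖(b + z 1)⁻¹‖ ≤ (ε + Im z)⁻¹ < ‖s‖⁻¹` when `s ≠ 0`, so the Neumann series converges.
  have hzero : ∀ z : ℂ, ‖s‖ < z.im → h z = 0 := by
    intro z hz
    have hz0 : 0 < z.im := (norm_nonneg s).trans_lt hz
    have hlez := smul_one_le_imaginaryPart_add hle z
    have hmz := hmem z (by simp only [U, Set.mem_ofPred_eq]; linarith)
    have hn := norm_inverse_le_of_smul_one_le_imaginaryPart (by positivity) hlez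
    have hlt : ‖s * P.ι (Ring.inverse (b + z • (1 : B)))‖ < 1 := by
      calc ‖s * P.ι (Ring.inverse (b + z • (1 : B)))‖
          ≤ ‖s‖ * ‖P.ι (Ring.inverse (b + z • (1 : B)))‖ := norm_mul_le _ _
        _ ≤ ‖s‖ * (ε + z.im)⁻¹ := by
          gcongr
          exact (NonUnitalStarAlgHom.norm_apply_le P.ι _).trans hn
        _ < 1 := by
          rw [← div_eq_mul_inv, div_lt_one (by positivity)]
          linarith
    have := hs.equation_of_norm_lt (isUnit_of_mem_upperHalfPlane hmz) hlt
    simp only [h, g]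
    rw [this]
    exact sub_eq_zero.2 (add_sub_cancel_left _ _)
  set z₀ : ℂ := ((‖s‖ + 1 : ℝ) : ℂ) * Complex.I
  have hz₀im : z₀.im = ‖s‖ + 1 := by simp [z₀]
  have hz₀ : z₀ ∈ U := by
    simp only [U, Set.mem_ofPred_eq, hz₀im]
    linarith [norm_nonneg s]
  have hev : h =ᶠ[nhds z₀] 0 := by
    have : {z : ℂ | ‖s‖ < z.im} ∈ nhds z₀ :=
      (isOpen_lt continuous_const Complex.continuous_im).mem_nhds
        (by simp only [Set.mem_ofPred_eq, hz₀im]; linarith)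
    filter_upwards [this] with z hz using hzero z hz
  have hall := (hh.analyticOnNhd hUo).eqOn_zero_of_preconnected_of_eventuallyEq_zero hUc hz₀ hev
  have h0 : h 0 = 0 := hall (by simpa [U] using hε)
  simp only [h, g, zero_smul, add_zero] at h0
  rw [sub_sub, sub_eq_zero] at h0
  exact h0

end OpValuedCStarProbSpace

/-! ### Perturbation of the equation and the final estimates -/

variable {A B : Type*} [CStarAlgebra A] [CStarAlgebra B] [PartialOrder B] [StarOrderedRing B]

theorem smul_one_le_imaginaryPart_sub {b d : B} {ε δ : ℝ} (h : ε • (1 : B) ≤ (ℑ b : B))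
    (hd : ‖d‖ ≤ δ) : (ε - δ) • (1 : B) ≤ (ℑ (b - d) : B) := by
  have h1 : (ℑ d : B) ≤ δ • (1 : B) := by
    refine (IsSelfAdjoint.le_algebraMap_norm_self (ℑ d).2).trans ?_
    rw [Algebra.algebraMap_eq_smul_one]
    have : (0 : B) ≤ 1 := zero_le_one
    gcongr
    exact (imaginaryPart.norm_le d).trans hd
  rw [map_sub, AddSubgroupClass.coe_sub, sub_smul]
  exact sub_le_sub h h1

theorem sub_Delta_mul (η : B →CP B) (b : B) {w : B} (hw : w ∈ lowerHalfPlane B) :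
    (b - Delta η b w) * w = 1 + η w * w := by
  have : b - Delta η b w = Ring.inverse w + η w := by rw [Delta]; abel
  rw [this, add_mul, Ring.inverse_mul_cancel _ (isUnit_of_mem_lowerHalfPlane hw)]

end OpValued

theorem mainTheorem1 {A B : Type*} [CStarAlgebra A] [CStarAlgebra B] [PartialOrder B]
    [StarOrderedRing B] (P : OpValued.OpValuedCStarProbSpace A B) (η : B →CP B) (s : A)
    (hs : P.IsCenteredSemicircular s η) (b : B) (hb : b ∈ OpValued.upperHalfPlane B) :
    (P.cauchyTransform s b ∈ OpValued.lowerHalfPlane B ∧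
      b * P.cauchyTransform s b = 1 + η (P.cauchyTransform s b) * P.cauchyTransform s b ∧
      ∀ w ∈ OpValued.lowerHalfPlane B, b * w = 1 + η w * w → w = P.cauchyTransform s b) ∧
    ∀ σ : ℝ, 0 < σ → σ < 1 → ∀ w ∈ OpValued.lowerHalfPlane B,
      ‖OpValued.Delta η b w‖ ≤ σ * ‖Ring.inverse (ℑ b : B)‖⁻¹ →
      (‖w - P.cauchyTransform s b‖
          ≤ 1 / (1 - σ) * ‖Ring.inverse (ℑ b : B)‖ ^ 2 * ‖OpValued.Delta η b w‖ ∧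
        1 / (1 - σ) * ‖Ring.inverse (ℑ b : B)‖ ^ 2 * ‖OpValued.Delta η b w‖
          ≤ σ / (1 - σ) * ‖Ring.inverse (ℑ b : B)‖) ∧
      ∀ φ : B →L[ℂ] ℂ, OpValued.IsState φ →
        ‖φ w - φ (P.cauchyTransform s b)‖
          ≤ 1 / (1 - σ) * √(P.Theta φ s b) * ‖Ring.inverse (ℑ b : B)‖ ^ 2
              * ‖OpValued.Delta η b w‖ ∧
        1 / (1 - σ) * √(P.Theta φ s b) * ‖Ring.inverse (ℑ b : B)‖ ^ 2 * ‖OpValued.Delta η b w‖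
          ≤ σ / (1 - σ) * √(P.Theta φ s b) * ‖Ring.inverse (ℑ b : B)‖ := by
  have hsa := hs.isSelfAdjoint
  -- Needed at every point, since it is applied at both `b` and `b - D`.
  have huniq : ∀ b' ∈ OpValued.upperHalfPlane B, ∀ w ∈ OpValued.lowerHalfPlane B,
      b' * w = 1 + η w * w → w = P.cauchyTransform s b' := fun b' hb' w hw h =>
    OpValued.eq_of_mul_eq_one_add η hb' hw (P.cauchyTransform_mem_lowerHalfPlane hsa hb') h
      (hs.equation hb')
  refine ⟨⟨P.cauchyTransform_mem_lowerHalfPlane hsa hb, hs.equation hb, huniq b hb⟩, ?_⟩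
  intro σ hσ0 hσ1 w hw hΔ
  have hbpos := OpValued.mem_upperHalfPlane_iff.1 hb
  have hκle := OpValued.inv_norm_inverse_smul_one_le hbpos
  set N := ‖Ring.inverse (ℑ b : B)‖ with hN
  set D := OpValued.Delta η b w with hD
  have h1σ : 0 < 1 - σ := by linarith
  -- In the zero algebra `N = 0`, so division by `N` has to be excluded.
  rcases subsingleton_or_nontrivial B with hB | hB
  · have hz : ∀ x : B, x = 0 := fun x => Subsingleton.elim _ _
    have hN0 : N = 0 := by rw [hN, hz (Ring.inverse _), norm_zero]
    rw [hN0, hz (w - _), hz w, hz (P.cauchyTransform s b)]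
    simp
  have hN0 : 0 < N := OpValued.norm_inverse_pos hbpos.isUnit
  have hND : N * ‖D‖ ≤ σ := by
    calc N * ‖D‖ ≤ N * (σ * N⁻¹) := by gcongr
      _ = σ := by field_simp
  have hle' : ((1 - σ) * N⁻¹) • (1 : B) ≤ (ℑ (b - D) : B) := by
    have := OpValued.smul_one_le_imaginaryPart_sub hκle hΔ
    convert this using 2
    ring
  have hpos' : 0 < (1 - σ) * N⁻¹ := by positivity
  have hb' : b - D ∈ OpValued.upperHalfPlane B := ⟨_, hpos', hle'⟩
  have hwG := huniq _ hb' w hw (OpValued.sub_Delta_mul η b hw)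
  have hdiff := P.cauchyTransform_sub_cauchyTransform (P.isUnit_ι_sub hsa hb)
    (P.isUnit_ι_sub hsa hb')
  rw [← hwG, sub_sub_cancel] at hdiff
  have hx := P.norm_inverse_ι_sub_le hsa hpos' hle'
  have hy := P.norm_inverse_ι_sub_le hsa (inv_pos.2 hN0) hκle
  rw [inv_inv] at hy
  rw [mul_inv, inv_inv] at hx
  have hxD : ‖Ring.inverse (P.ι (b - D) - s) * P.ι D‖ ≤ (1 - σ)⁻¹ * N * ‖D‖ := by
    refine (norm_mul_le _ _).trans ?_
    gcongr
    exact NonUnitalStarAlgHom.norm_apply_le P.ι D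
  refine ⟨⟨?_, ?_⟩, fun φ hφ => ⟨?_, ?_⟩⟩
  · rw [hdiff]
    calc _ ≤ _ := P.norm_E_le _
      _ ≤ ‖Ring.inverse (P.ι (b - D) - s) * P.ι D‖ * ‖Ring.inverse (P.ι b - s)‖ := norm_mul_le _ _
      _ ≤ ((1 - σ)⁻¹ * N * ‖D‖) * N := by gcongr
      _ = _ := by ring
  · calc 1 / (1 - σ) * N ^ 2 * ‖D‖ = 1 / (1 - σ) * N * (N * ‖D‖) := by ring
      _ ≤ 1 / (1 - σ) * N * σ := by gcongr
      _ = _ := by ring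
  · have hcs := P.norm_state_E_mul_le hφ (Ring.inverse (P.ι (b - D) - s) * P.ι D)
      (Ring.inverse (P.ι b - s))
    have hq := P.state_E_star_inverse_mul_inverse_le hφ hsa (inv_pos.2 hN0) hκle
    set q := (φ (P.E (star (Ring.inverse (P.ι b - s)) * Ring.inverse (P.ι b - s)))).re
    -- `N⁻¹ q ≤ -Im φ(G)` and `-Im φ(G) = N Θ`, hence `q ≤ N² Θ`.
    have hsq : √q ≤ N * √(P.Theta φ s b) := by
      rw [← Real.sqrt_sq hN0.le, ← Real.sqrt_mul (by positivity)]
      apply Real.sqrt_le_sqrt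
      rw [OpValued.OpValuedCStarProbSpace.Theta, ← hN]
      calc q = N * (N⁻¹ * q) := by field_simp
        _ ≤ N * -(φ (P.cauchyTransform s b)).im := by gcongr
        _ = _ := by field_simp
    rw [← map_sub, hdiff]
    calc _ ≤ _ := hcs
      _ ≤ ((1 - σ)⁻¹ * N * ‖D‖) * (N * √(P.Theta φ s b)) := by gcongr
      _ = _ := by ring
  · calc 1 / (1 - σ) * √(P.Theta φ s b) * N ^ 2 * ‖D‖
        = 1 / (1 - σ) * √(P.Theta φ s b) * N * (N * ‖D‖) := by ring
      _ ≤ 1 / (1 - σ) * √(P.Theta φ s b) * N * σ := by gcongr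
      _ = _ := by ring
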